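/- **Conventions.** A left act of a monoid $S$ is a set $A$ with an action $S\times A\to A$ such that $1a=a$ and $s(ta)=(st)a$; right acts are defined dually. The free left $S$-act on a set $Y$ is $Y\times S$ with $t(y,s)=(y,ts)$. An $S$-act is *finitely presented* if it is isomorphic to $F/\rho$, where $F$ is the free act on a finite set and $\rho$ is a finitely generated act congruence on $F$. A monoid $S$ is *left (right) coherent* if every finitely generated subact of every finitely presented left (right) $S$-act is finitely presented. Let $E$ be a semilattice of idempotents of a monoid $S$ (commuting idempotents, closed under products). Write $a\,\widetilde{\mathcal R}_E\,b$ if $a$ and $b$ have the same left identities from $E$. Then $S$ is *left $E$-Ehresmann* if $\widetilde{\mathcal R}_E$ is a left congruence and every $\widetilde{\mathcal R}_E$-class contains exactly one element of $E$; the element of $E$ in the class of $a$ is denoted $a^+$. Dually, with right identities and $\widetilde{\mathcal L}_E$, one defines *right $E$-Ehresmann* monoids and $a^*$. A *left Ehresmann monoid* is a monoid that is left $E$-Ehresmann for some $E$, regarded as a unary monoid with the operation $a\mapsto a^+$; an *Ehresmann monoid* is a monoid that is both left and right $E$-Ehresmann for the same $E$, regarded as a bi-unary monoid with the operations $a\mapsto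 a^+$ and $a\mapsto a^*$. Each of these classes is a variety. Let $\mathrm{FLAd}(X)$ be the free left Ehresmann monoid on the set $X$ and $\mathrm{FAd}(X)$ the free Ehresmann monoid on $X$, that is, the free algebras on $X$ in these varieties of unary and bi-unary monoids, respectively. **Theorem.** Let $X$ be a set with $|X|>1$. Then, regarded as monoids, 1. $\mathrm{FAd}(X)$ is not left coherent and is not right coherent; 2. $\mathrm{FLAd}(X)$ is not left coherent. -/

import Mathlib

universe u v

/-! ### Left acts, finite presentability, coherence

A left `S`-act is a `MulAction S A`; a right `S`-act is a left act of the opposite monoid,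
`MulAction Sᵐᵒᵖ A`, as usual in Mathlib. -/

/-- The free left `S`-act on a set `X`: the set `X × S` with `t • (x, s) = (x, t * s)`. -/
abbrev FreeAct (S : Type u) (X : Type v) : Type (max u v) := (_ : X) × S

/-- `ρ` is the smallest act congruence containing `Y`. -/
def SMulCon.IsGeneratedBy {S : Type u} {A : Type v} [SMul S A] (ρ : SMulCon S A)
    (Y : Set (A × A)) : Prop :=
  (∀ p ∈ Y, ρ.toSetoid p.1 p.2) ∧
    ∀ σ : SMulCon S A, (∀ p ∈ Y, σ.toSetoid p.1 p.2) →
      ∀ a b, ρ.toSetoid a b → σ.toSetoid a b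

/-- An act congruence is finitely generated if it is generated by a finite set of pairs. -/
def SMulCon.IsFinitelyGenerated {S : Type u} {A : Type v} [SMul S A] (ρ : SMulCon S A) : Prop :=
  ∃ Y : Set (A × A), Y.Finite ∧ ρ.IsGeneratedBy Y

/-- A left `S`-act is finitely presented if it is isomorphic to `F / ρ`, with `F` the free act on
a finite set and `ρ` a finitely generated congruence on `F`. -/
def IsFinitelyPresentedAct (S : Type u) [Monoid S] (A : Type v) [MulAction S A] : Prop :=
  ∃ (n : ℕ) (ρ : SMulCon S (FreeAct S (Fin n))), ρ.IsFinitelyGenerated ∧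
    ∃ f : ρ.Quotient →[S] A, Function.Bijective f

/-- A subact `B` is finitely generated if `B = S Y` for a finite set `Y`. -/
def SubMulAction.IsFinitelyGenerated {S : Type u} [Monoid S] {A : Type v} [MulAction S A]
    (B : SubMulAction S A) : Prop :=
  ∃ Y : Set A, Y.Finite ∧ (B : Set A) = {a | ∃ y ∈ Y, ∃ s : S, a = s • y}

/-- `S` is left coherent if every finitely generated subact of every finitely presented left
`S`-act is finitely presented. (Up to isomorphism, all finitely presented `S`-acts live in the
universe of `S`.) -/
def IsLeftCoherent (S : Type u) [Monoid S] : Prop :=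
  ∀ (A : Type u) [MulAction S A], IsFinitelyPresentedAct S A →
    ∀ B : SubMulAction S A, B.IsFinitelyGenerated → IsFinitelyPresentedAct S B

/-- `S` is right coherent if every finitely generated subact of every finitely presented right
`S`-act is finitely presented; right `S`-acts are the left acts of `Sᵐᵒᵖ`. -/
def IsRightCoherent (S : Type u) [Monoid S] : Prop :=
  IsLeftCoherent Sᵐᵒᵖ

/-! ### Ehresmann monoids -/

section Ehresmann

variable {S : Type u} [Monoid S]

/-- `a` and `b` have the same left identities from `E`. -/
def TildeR (E : Set S) (a b : S) : Prop := ∀ e ∈ E, e * a = a ↔ e * b = b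

/-- `a` and `b` have the same right identities from `E`. -/
def TildeL (E : Set S) (a b : S) : Prop := ∀ e ∈ E, a * e = a ↔ b * e = b

/-- `E` is a subsemilattice of the monoid: it consists of commuting idempotents and is closed
under products. -/
structure IsSemilatticeIn (E : Set S) : Prop where
  idem : ∀ e ∈ E, e * e = e
  comm : ∀ e ∈ E, ∀ f ∈ E, e * f = f * e
  mul_mem : ∀ e ∈ E, ∀ f ∈ E, e * f ∈ E

/-- `S` is left `E`-Ehresmann. -/
structure IsLeftEhresmann (E : Set S) : Prop extends IsSemilatticeIn E where
  existsUnique : ∀ a, ∃! e, e ∈ E ∧ TildeR E a e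
  leftCongruence : ∀ a b c, TildeR E a b → TildeR E (c * a) (c * b)

/-- `S` is right `E`-Ehresmann. -/
structure IsRightEhresmann (E : Set S) : Prop extends IsSemilatticeIn E where
  existsUnique : ∀ a, ∃! e, e ∈ E ∧ TildeL E a e
  rightCongruence : ∀ a b c, TildeL E a b → TildeL E (a * c) (b * c)

/-- The unary-monoid identities of left Ehresmann monoids. -/
structure LeftEhresmannIdentities (p : S → S) : Prop where
  plus_mul_self : ∀ a, p a * a = a
  plus_comm : ∀ a b, p a * p b = p b * p a
  plus_plus : ∀ a b, p (p a * p b) = p a * p b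
  plus_mul : ∀ a b, p (a * b) = p (a * p b)

/-- The unary-monoid identities of right Ehresmann monoids. -/
structure RightEhresmannIdentities (q : S → S) : Prop where
  self_mul_star : ∀ a, a * q a = a
  star_comm : ∀ a b, q a * q b = q b * q a
  star_star : ∀ a b, q (q a * q b) = q a * q b
  star_mul : ∀ a b, q (a * b) = q (q a * b)

theorem leftEhresmann_iff_identities (p : S → S) :
    (IsLeftEhresmann (Set.range p) ∧ ∀ a, TildeR (Set.range p) a (p a)) ↔
      LeftEhresmannIdentities p := by
  constructor
  · rintro ⟨h, ht⟩
    have huniq : ∀ a e, e ∈ Set.range p → TildeR (Set.range p) a e → p a = e := fun a e he hae =>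
      (h.existsUnique a).unique ⟨⟨a, rfl⟩, ht a⟩ ⟨he, hae⟩
    refine ⟨fun a => (ht a (p a) ⟨a, rfl⟩).2 (h.idem _ ⟨a, rfl⟩),
      fun a b => h.comm _ ⟨a, rfl⟩ _ ⟨b, rfl⟩,
      fun a b => huniq _ _ (h.mul_mem _ ⟨a, rfl⟩ _ ⟨b, rfl⟩) (fun _ _ => Iff.rfl), fun a b => ?_⟩
    refine huniq _ _ ⟨_, rfl⟩ fun e he => ?_
    exact (h.leftCongruence _ _ a (ht b) e he).trans (ht (a * p b) e he)
  · intro h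
    have hpp : ∀ a, p (p a) = p a := fun a => by
      have := h.plus_mul 1 a
      simpa using this.symm
    have hid : ∀ a, p a * p a = p a := fun a => by
      rw [← h.plus_plus, ← h.plus_mul, h.plus_mul_self]
    have ht : ∀ a, TildeR (Set.range p) a (p a) := by
      rintro a _ ⟨c, rfl⟩
      constructor
      · intro hc
        calc p c * p a = p (p c * p a) := (h.plus_plus c a).symm
          _ = p (p c * a) := (h.plus_mul _ _).symm
          _ = p a := by rw [hc]
      · intro hc
        calc p c * a = p c * (p a * a) := by rw [h.plus_mul_self]
          _ = p a * a := by rw [← mul_assoc, hc]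
          _ = a := h.plus_mul_self a
    have huniq : ∀ e ∈ Set.range p, ∀ f ∈ Set.range p, TildeR (Set.range p) e f → e = f := by
      rintro _ ⟨a, rfl⟩ _ ⟨b, rfl⟩ hef
      have h1 := (hef (p a) ⟨a, rfl⟩).1 (hid a)
      have h2 := (hef (p b) ⟨b, rfl⟩).2 (hid b)
      rw [← h2, ← h.plus_comm, h1]
    refine ⟨⟨⟨?_, ?_, ?_⟩, fun a => ⟨p a, ⟨⟨a, rfl⟩, ht a⟩, ?_⟩, ?_⟩, ht⟩
    · rintro _ ⟨a, rfl⟩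
      exact hid a
    · rintro _ ⟨a, rfl⟩ _ ⟨b, rfl⟩
      exact h.plus_comm a b
    · rintro _ ⟨a, rfl⟩ _ ⟨b, rfl⟩
      exact ⟨_, h.plus_plus a b⟩
    · rintro e ⟨he, hae⟩
      exact huniq _ he _ ⟨a, rfl⟩ fun f hf => (hae f hf).symm.trans (ht a f hf)
    · intro a b c hab
      have hpab : p a = p b := huniq _ ⟨a, rfl⟩ _ ⟨b, rfl⟩ fun f hf =>
        (ht a f hf).symm.trans ((hab f hf).trans (ht b f hf))
      intro f hf
      rw [ht (c * a) f hf, ht (c * b) f hf, h.plus_mul c a, h.plus_mul c b, hpab]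

theorem rightEhresmann_iff_identities (q : S → S) :
    (IsRightEhresmann (Set.range q) ∧ ∀ a, TildeL (Set.range q) a (q a)) ↔
      RightEhresmannIdentities q := by
  constructor
  · rintro ⟨h, ht⟩
    have huniq : ∀ a e, e ∈ Set.range q → TildeL (Set.range q) a e → q a = e := fun a e he hae =>
      (h.existsUnique a).unique ⟨⟨a, rfl⟩, ht a⟩ ⟨he, hae⟩
    refine ⟨fun a => (ht a (q a) ⟨a, rfl⟩).2 (h.idem _ ⟨a, rfl⟩),
      fun a b => h.comm _ ⟨a, rfl⟩ _ ⟨b, rfl⟩,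
      fun a b => huniq _ _ (h.mul_mem _ ⟨a, rfl⟩ _ ⟨b, rfl⟩) (fun _ _ => Iff.rfl), fun a b => ?_⟩
    refine huniq _ _ ⟨_, rfl⟩ fun e he => ?_
    exact (h.rightCongruence _ _ b (ht a) e he).trans (ht (q a * b) e he)
  · intro h
    have hqq : ∀ a, q (q a) = q a := fun a => by
      have := h.star_mul a 1
      simpa using this.symm
    have hid : ∀ a, q a * q a = q a := fun a => by
      rw [← h.star_star, ← h.star_mul, h.self_mul_star]
    have ht : ∀ a, TildeL (Set.range q) a (q a) := by
      rintro a _ ⟨c, rfl⟩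
      constructor
      · intro hc
        calc q a * q c = q (q a * q c) := (h.star_star a c).symm
          _ = q (a * q c) := (h.star_mul _ _).symm
          _ = q a := by rw [hc]
      · intro hc
        calc a * q c = (a * q a) * q c := by rw [h.self_mul_star]
          _ = a * q a := by rw [mul_assoc, hc]
          _ = a := h.self_mul_star a
    have huniq : ∀ e ∈ Set.range q, ∀ f ∈ Set.range q, TildeL (Set.range q) e f → e = f := by
      rintro _ ⟨a, rfl⟩ _ ⟨b, rfl⟩ hef
      have h1 := (hef (q a) ⟨a, rfl⟩).1 (hid a)
      have h2 := (hef (q b) ⟨b, rfl⟩).2 (hid b)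
      rw [← h2, ← h.star_comm, h1]
    refine ⟨⟨⟨?_, ?_, ?_⟩, fun a => ⟨q a, ⟨⟨a, rfl⟩, ht a⟩, ?_⟩, ?_⟩, ht⟩
    · rintro _ ⟨a, rfl⟩
      exact hid a
    · rintro _ ⟨a, rfl⟩ _ ⟨b, rfl⟩
      exact h.star_comm a b
    · rintro _ ⟨a, rfl⟩ _ ⟨b, rfl⟩
      exact ⟨_, h.star_star a b⟩
    · rintro e ⟨he, hae⟩
      exact huniq _ he _ ⟨a, rfl⟩ fun f hf => (hae f hf).symm.trans (ht a f hf)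
    · intro a b c hab
      have hqab : q a = q b := huniq _ ⟨a, rfl⟩ _ ⟨b, rfl⟩ fun f hf =>
        (ht a f hf).symm.trans ((hab f hf).trans (ht b f hf))
      intro f hf
      rw [ht (a * c) f hf, ht (b * c) f hf, h.star_mul a c, h.star_mul b c, hqab]

end Ehresmann

/-- A left Ehresmann monoid as a unary monoid: `S` is left `E`-Ehresmann for a semilattice of
idempotents `E`, and `plus a` is the element of `E` with the same left identities from `E` as `a`.
Then `E` is the set of all elements `plus a`. -/
class LeftEhresmannMonoid (S : Type u) extends Monoid S where
  plus : S → S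
  isLeftEhresmann : IsLeftEhresmann (Set.range plus)
  tildeR_plus : ∀ a, TildeR (Set.range plus) a (plus a)

/-- A (two-sided) Ehresmann monoid as a bi-unary monoid: `S` is left and right `E`-Ehresmann for
the same semilattice `E`, with `E` the set of all `plus a` and also the set of all `star a`. -/
class EhresmannMonoid (S : Type u) extends LeftEhresmannMonoid S where
  star : S → S
  range_star : Set.range star = Set.range plus
  isRightEhresmann : IsRightEhresmann (Set.range star)
  tildeL_star : ∀ a, TildeL (Set.range star) a (star a)

/-! ### The free left Ehresmann monoid -/

/-- Terms over `X` in the signature of unary monoids. -/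
inductive LTerm (X : Type u) : Type u
  | var : X → LTerm X
  | one : LTerm X
  | mul : LTerm X → LTerm X → LTerm X
  | plus : LTerm X → LTerm X

/-- The fully invariant congruence on terms given by the identities of left Ehresmann monoids. -/
inductive LTerm.Rel {X : Type u} : LTerm X → LTerm X → Prop
  | refl (a : LTerm X) : Rel a a
  | symm {a b : LTerm X} : Rel a b → Rel b a
  | trans {a b c : LTerm X} : Rel a b → Rel b c → Rel a c
  | mul_congr {a b c d : LTerm X} : Rel a b → Rel c d → Rel (a.mul c) (b.mul d)
  | plus_congr {a b : LTerm X} : Rel a b → Rel a.plus b.plus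
  | mul_assoc (a b c : LTerm X) : Rel ((a.mul b).mul c) (a.mul (b.mul c))
  | one_mul (a : LTerm X) : Rel (one.mul a) a
  | mul_one (a : LTerm X) : Rel (a.mul one) a
  | plus_mul_self (a : LTerm X) : Rel (a.plus.mul a) a
  | plus_comm (a b : LTerm X) : Rel (a.plus.mul b.plus) (b.plus.mul a.plus)
  | plus_plus (a b : LTerm X) : Rel (a.plus.mul b.plus).plus (a.plus.mul b.plus)
  | plus_mul (a b : LTerm X) : Rel (a.mul b).plus (a.mul b.plus).plus

/-- The setoid of the congruence on terms. -/
instance LTerm.setoid (X : Type u) : Setoid (LTerm X) where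
  r := LTerm.Rel
  iseqv := ⟨.refl, .symm, .trans⟩

/-- The free left Ehresmann monoid on `X`, that is, the free algebra on `X` in the variety of left
Ehresmann monoids (as unary monoids). -/
def FLAd (X : Type u) : Type u := Quotient (LTerm.setoid X)

namespace FLAd

variable {X : Type u}

/-- The canonical map from the generating set. -/
def of (x : X) : FLAd X := Quotient.mk _ (.var x)

instance : Monoid (FLAd X) where
  one := Quotient.mk _ .one
  mul := Quotient.map₂ .mul fun _ _ h _ _ h' => .mul_congr h h'
  mul_assoc := by
    rintro ⟨a⟩ ⟨b⟩ ⟨c⟩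
    exact Quotient.sound (.mul_assoc a b c)
  one_mul := by
    rintro ⟨a⟩
    exact Quotient.sound (.one_mul a)
  mul_one := by
    rintro ⟨a⟩
    exact Quotient.sound (.mul_one a)

/-- The operation `a ↦ a⁺`. -/
def plus : FLAd X → FLAd X := Quotient.map .plus fun _ _ h => .plus_congr h

theorem identities : LeftEhresmannIdentities (plus : FLAd X → FLAd X) where
  plus_mul_self := by
    rintro ⟨a⟩
    exact Quotient.sound (.plus_mul_self a)
  plus_comm := by
    rintro ⟨a⟩ ⟨b⟩
    exact Quotient.sound (.plus_comm a b)
  plus_plus := by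
    rintro ⟨a⟩ ⟨b⟩
    exact Quotient.sound (.plus_plus a b)
  plus_mul := by
    rintro ⟨a⟩ ⟨b⟩
    exact Quotient.sound (.plus_mul a b)

instance : LeftEhresmannMonoid (FLAd X) where
  plus := plus
  isLeftEhresmann := ((leftEhresmann_iff_identities _).2 identities).1
  tildeR_plus := ((leftEhresmann_iff_identities _).2 identities).2

/-- The value of a term under an assignment of the variables. -/
def eval {S : Type v} [LeftEhresmannMonoid S] (g : X → S) : LTerm X → S
  | .var x => g x
  | .one => 1
  | .mul a b => eval g a * eval g b
  | .plus a => LeftEhresmannMonoid.plus (eval g a)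

theorem eval_eq {S : Type v} [LeftEhresmannMonoid S] (g : X → S) {a b : LTerm X}
    (h : LTerm.Rel a b) : eval g a = eval g b := by
  have hS := (leftEhresmann_iff_identities (LeftEhresmannMonoid.plus : S → S)).1
    ⟨LeftEhresmannMonoid.isLeftEhresmann, LeftEhresmannMonoid.tildeR_plus⟩
  induction h with
  | refl => rfl
  | symm _ ih => exact ih.symm
  | trans _ _ ih ih' => exact ih.trans ih'
  | mul_congr _ _ ih ih' => simp only [eval, ih, ih']
  | plus_congr _ ih => simp only [eval, ih]
  | mul_assoc => exact _root_.mul_assoc _ _ _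
  | one_mul => exact _root_.one_mul _
  | mul_one => exact _root_.mul_one _
  | plus_mul_self => exact hS.plus_mul_self _
  | plus_comm => exact hS.plus_comm _ _
  | plus_plus => exact hS.plus_plus _ _
  | plus_mul => exact hS.plus_mul _ _

/-- The universal property: `FLAd X` is the free left Ehresmann monoid on `X`. -/
theorem existsUnique_lift {S : Type v} [LeftEhresmannMonoid S] (g : X → S) :
    ∃! f : FLAd X →* S,
      (∀ a, f (LeftEhresmannMonoid.plus a) = LeftEhresmannMonoid.plus (f a)) ∧
      ∀ x, f (of x) = g x := by
  refine ⟨{ toFun := Quotient.lift (eval g) fun _ _ h => eval_eq g h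
            map_one' := rfl
            map_mul' := ?_ }, ⟨?_, fun _ => rfl⟩, ?_⟩
  · rintro ⟨a⟩ ⟨b⟩
    rfl
  · rintro ⟨a⟩
    rfl
  · rintro f ⟨hp, hx⟩
    ext t
    obtain ⟨t, rfl⟩ := Quotient.exists_rep t
    induction t with
    | var x => exact hx x
    | one => exact f.map_one
    | mul a b iha ihb => exact (f.map_mul _ _).trans (congrArg₂ (· * ·) iha ihb)
    | plus a ih => exact (hp _).trans (congrArg LeftEhresmannMonoid.plus ih)

end FLAd

/-! ### The free Ehresmann monoid -/

/-- Terms over `X` in the signature of bi-unary monoids. -/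
inductive ETerm (X : Type u) : Type u
  | var : X → ETerm X
  | one : ETerm X
  | mul : ETerm X → ETerm X → ETerm X
  | plus : ETerm X → ETerm X
  | star : ETerm X → ETerm X

/-- The fully invariant congruence on terms given by the identities of Ehresmann monoids. -/
inductive ETerm.Rel {X : Type u} : ETerm X → ETerm X → Prop
  | refl (a : ETerm X) : Rel a a
  | symm {a b : ETerm X} : Rel a b → Rel b a
  | trans {a b c : ETerm X} : Rel a b → Rel b c → Rel a c
  | mul_congr {a b c d : ETerm X} : Rel a b → Rel c d → Rel (a.mul c) (b.mul d)
  | plus_congr {a b : ETerm X} : Rel a b → Rel a.plus b.plus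
  | star_congr {a b : ETerm X} : Rel a b → Rel a.star b.star
  | mul_assoc (a b c : ETerm X) : Rel ((a.mul b).mul c) (a.mul (b.mul c))
  | one_mul (a : ETerm X) : Rel (one.mul a) a
  | mul_one (a : ETerm X) : Rel (a.mul one) a
  | plus_mul_self (a : ETerm X) : Rel (a.plus.mul a) a
  | plus_comm (a b : ETerm X) : Rel (a.plus.mul b.plus) (b.plus.mul a.plus)
  | plus_plus (a b : ETerm X) : Rel (a.plus.mul b.plus).plus (a.plus.mul b.plus)
  | plus_mul (a b : ETerm X) : Rel (a.mul b).plus (a.mul b.plus).plus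
  | self_mul_star (a : ETerm X) : Rel (a.mul a.star) a
  | star_comm (a b : ETerm X) : Rel (a.star.mul b.star) (b.star.mul a.star)
  | star_star (a b : ETerm X) : Rel (a.star.mul b.star).star (a.star.mul b.star)
  | star_mul (a b : ETerm X) : Rel (a.mul b).star (a.star.mul b).star
  | star_plus (a : ETerm X) : Rel a.plus.star a.plus
  | plus_star (a : ETerm X) : Rel a.star.plus a.star

/-- The setoid of the congruence on terms. -/
instance ETerm.setoid (X : Type u) : Setoid (ETerm X) where
  r := ETerm.Rel
  iseqv := ⟨.refl, .symm, .trans⟩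

/-- The free Ehresmann monoid on `X`, that is, the free algebra on `X` in the variety of Ehresmann
monoids (as bi-unary monoids). -/
def FAd (X : Type u) : Type u := Quotient (ETerm.setoid X)

namespace FAd

variable {X : Type u}

/-- The canonical map from the generating set. -/
def of (x : X) : FAd X := Quotient.mk _ (.var x)

instance : Monoid (FAd X) where
  one := Quotient.mk _ .one
  mul := Quotient.map₂ .mul fun _ _ h _ _ h' => .mul_congr h h'
  mul_assoc := by
    rintro ⟨a⟩ ⟨b⟩ ⟨c⟩
    exact Quotient.sound (.mul_assoc a b c)
  one_mul := by
    rintro ⟨a⟩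
    exact Quotient.sound (.one_mul a)
  mul_one := by
    rintro ⟨a⟩
    exact Quotient.sound (.mul_one a)

/-- The operation `a ↦ a⁺`. -/
def plus : FAd X → FAd X := Quotient.map .plus fun _ _ h => .plus_congr h

/-- The operation `a ↦ a*`. -/
def star : FAd X → FAd X := Quotient.map .star fun _ _ h => .star_congr h

theorem plus_identities : LeftEhresmannIdentities (plus : FAd X → FAd X) where
  plus_mul_self := by
    rintro ⟨a⟩
    exact Quotient.sound (.plus_mul_self a)
  plus_comm := by
    rintro ⟨a⟩ ⟨b⟩
    exact Quotient.sound (.plus_comm a b)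
  plus_plus := by
    rintro ⟨a⟩ ⟨b⟩
    exact Quotient.sound (.plus_plus a b)
  plus_mul := by
    rintro ⟨a⟩ ⟨b⟩
    exact Quotient.sound (.plus_mul a b)

theorem star_identities : RightEhresmannIdentities (star : FAd X → FAd X) where
  self_mul_star := by
    rintro ⟨a⟩
    exact Quotient.sound (.self_mul_star a)
  star_comm := by
    rintro ⟨a⟩ ⟨b⟩
    exact Quotient.sound (.star_comm a b)
  star_star := by
    rintro ⟨a⟩ ⟨b⟩
    exact Quotient.sound (.star_star a b)
  star_mul := by
    rintro ⟨a⟩ ⟨b⟩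
    exact Quotient.sound (.star_mul a b)

instance : EhresmannMonoid (FAd X) where
  plus := plus
  isLeftEhresmann := ((leftEhresmann_iff_identities _).2 plus_identities).1
  tildeR_plus := ((leftEhresmann_iff_identities _).2 plus_identities).2
  star := star
  range_star := by
    apply Set.Subset.antisymm
    · rintro _ ⟨⟨a⟩, rfl⟩
      exact ⟨star (Quotient.mk _ a), Quotient.sound (ETerm.Rel.plus_star a)⟩
    · rintro _ ⟨⟨a⟩, rfl⟩
      exact ⟨plus (Quotient.mk _ a), Quotient.sound (ETerm.Rel.star_plus a)⟩
  isRightEhresmann := ((rightEhresmann_iff_identities _).2 star_identities).1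
  tildeL_star := ((rightEhresmann_iff_identities _).2 star_identities).2

/-- The value of a term under an assignment of the variables. -/
def eval {S : Type v} [EhresmannMonoid S] (g : X → S) : ETerm X → S
  | .var x => g x
  | .one => 1
  | .mul a b => eval g a * eval g b
  | .plus a => LeftEhresmannMonoid.plus (eval g a)
  | .star a => EhresmannMonoid.star (eval g a)

theorem eval_eq {S : Type v} [EhresmannMonoid S] (g : X → S) {a b : ETerm X}
    (h : ETerm.Rel a b) : eval g a = eval g b := by
  have hp := (leftEhresmann_iff_identities (LeftEhresmannMonoid.plus : S → S)).1
    ⟨LeftEhresmannMonoid.isLeftEhresmann, LeftEhresmannMonoid.tildeR_plus⟩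
  have hq := (rightEhresmann_iff_identities (EhresmannMonoid.star : S → S)).1
    ⟨EhresmannMonoid.isRightEhresmann, EhresmannMonoid.tildeL_star⟩
  have hr := EhresmannMonoid.range_star (S := S)
  induction h with
  | refl => rfl
  | symm _ ih => exact ih.symm
  | trans _ _ ih ih' => exact ih.trans ih'
  | mul_congr _ _ ih ih' => simp only [eval, ih, ih']
  | plus_congr _ ih => simp only [eval, ih]
  | star_congr _ ih => simp only [eval, ih]
  | mul_assoc => exact _root_.mul_assoc _ _ _
  | one_mul => exact _root_.one_mul _
  | mul_one => exact _root_.mul_one _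
  | plus_mul_self => exact hp.plus_mul_self _
  | plus_comm => exact hp.plus_comm _ _
  | plus_plus => exact hp.plus_plus _ _
  | plus_mul => exact hp.plus_mul _ _
  | self_mul_star => exact hq.self_mul_star _
  | star_comm => exact hq.star_comm _ _
  | star_star => exact hq.star_star _ _
  | star_mul => exact hq.star_mul _ _
  | star_plus a =>
    obtain ⟨c, hc⟩ := hr.symm ▸ Set.mem_range_self (f := LeftEhresmannMonoid.plus) (eval g a)
    have := hq.star_mul c 1
    simp only [_root_.mul_one] at this
    simp only [eval]
    rw [← hc, ← this]
  | plus_star a =>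
    obtain ⟨c, hc⟩ := hr ▸ Set.mem_range_self (f := EhresmannMonoid.star) (eval g a)
    have := hp.plus_mul 1 c
    simp only [_root_.one_mul] at this
    simp only [eval]
    rw [← hc, ← this]

/-- The universal property: `FAd X` is the free Ehresmann monoid on `X`. -/
theorem existsUnique_lift {S : Type v} [EhresmannMonoid S] (g : X → S) :
    ∃! f : FAd X →* S,
      (∀ a, f (LeftEhresmannMonoid.plus a) = LeftEhresmannMonoid.plus (f a)) ∧
      (∀ a, f (EhresmannMonoid.star a) = EhresmannMonoid.star (f a)) ∧
      ∀ x, f (of x) = g x := by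
  refine ⟨{ toFun := Quotient.lift (eval g) fun _ _ h => eval_eq g h
            map_one' := rfl
            map_mul' := ?_ }, ⟨?_, ?_, fun _ => rfl⟩, ?_⟩
  · rintro ⟨a⟩ ⟨b⟩
    rfl
  · rintro ⟨a⟩
    rfl
  · rintro ⟨a⟩
    rfl
  · rintro f ⟨hp, hq, hx⟩
    ext t
    obtain ⟨t, rfl⟩ := Quotient.exists_rep t
    induction t with
    | var x => exact hx x
    | one => exact f.map_one
    | mul a b iha ihb => exact (f.map_mul _ _).trans (congrArg₂ (· * ·) iha ihb)
    | plus a ih => exact (hp _).trans (congrArg LeftEhresmannMonoid.plus ih)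
    | star a ih => exact (hq _).trans (congrArg EhresmannMonoid.star ih)

end FAd

/-!
In the finitely presented act `⟨w | w = x w⟩`, two elements `s w` and `t w` are equal if and only if
`s x^k = t x^l` for some `k` and `l`. If distinct elements `y x^k` and `y x^l` have no common left
multiple, then the annihilator congruence of `y w` is the union over `k` of the annihilators of
`y x^k`. In a left coherent monoid it would be finitely generated, so this ascending chain would
become stationary. It does not, because `(y x^(k+1))⁺` fixes `y x^(k+1)` but not `y x^k`.

For distinct free generators `x` and `y`, both properties are seen in homomorphic images: the
exponent `k` is recovered from `u y x^k` by letting `x` act on the right of `ℕ` as the successor map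
and `y` as the zero map, and `(y x^(k+1))⁺ y x^k ≠ y x^k` holds in the bicyclic monoid when `y` is
sent to `1` and `x` to a generator. Right coherence reduces to left coherence as the opposite of an
Ehresmann monoid is again Ehresmann, with `⁺` and `*` exchanged.
-/

open Filter MulOpposite

/-! ### Finitely generated congruences -/

theorem eventually_forall_rel_of_isFinitelyGenerated {S A ι : Type*} [SMul S A]
    {ρ : SMulCon S A} (hρ : ρ.IsFinitelyGenerated) {l : Filter ι} {σ : ι → SMulCon S A}
    (h : ∀ a b, ρ.toSetoid a b → ∀ᶠ i in l, (σ i).toSetoid a b) :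
    ∀ᶠ i in l, ∀ a b, ρ.toSetoid a b → (σ i).toSetoid a b := by
  obtain ⟨Y, hYfin, hYρ, hYmin⟩ := hρ
  have hY : ∀ᶠ i in l, ∀ p ∈ Y, (σ i).toSetoid p.1 p.2 :=
    (eventually_all_finite hYfin).2 fun p hp => h _ _ (hYρ p hp)
  exact hY.mono fun i hi => hYmin (σ i) hi

section Acts

variable {S : Type u} [Monoid S] {A B : Type*} [MulAction S A] [MulAction S B]

/-- The act homomorphism out of a free act determined by the images of the free generators. -/
def FreeAct.lift {ι : Type*} (g : ι → A) : FreeAct S ι →[S] A where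
  toFun a := a.2 • g a.1
  map_smul' s a := mul_smul s a.2 (g a.1)

variable (S) in
/-- The act homomorphism `s ↦ s • z` from `S` to an act. Its kernel is the left annihilator
congruence of `z`. -/
def orbitMap (z : A) : S →[S] A where
  toFun s := s • z
  map_smul' s t := mul_smul s t z

theorem FreeAct.exists_comp_eq {ι : Type*} {g : A →[S] B} (hg : Function.Surjective g)
    (π : FreeAct S ι →[S] B) : ∃ φ : FreeAct S ι →[S] A, ∀ a, g (φ a) = π a := by
  choose t ht using fun i => hg (π ⟨i, 1⟩)
  refine ⟨FreeAct.lift t, fun ⟨i, s⟩ => ?_⟩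
  calc g (s • t i) = π (s • ⟨i, 1⟩) := by rw [map_smul, ht, map_smul]
    _ = π ⟨i, s⟩ := congrArg (fun r => π ⟨i, r⟩) (mul_one s)

theorem IsFinitelyPresentedAct.exists_surjective_ker_isFinitelyGenerated
    (hB : IsFinitelyPresentedAct S B) : ∃ (n : ℕ) (π : FreeAct S (Fin n) →[S] B),
      Function.Surjective π ∧ (SMulCon.ker π).IsFinitelyGenerated := by
  obtain ⟨n, ρ, ⟨Y, hYfin, hYρ, hYmin⟩, f, hf⟩ := hB
  let mk : FreeAct S (Fin n) →[S] ρ.Quotient := ⟨Quotient.mk ρ.toSetoid, fun _ _ => rfl⟩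
  refine ⟨n, f.comp mk, hf.2.comp Quotient.mk_surjective, Y, hYfin, fun p hp => ?_,
    fun σ hσ a b hab => hYmin σ hσ a b (Quotient.exact (hf.1 hab))⟩
  exact congrArg f (Quotient.sound (hYρ p hp))

/-- With `φ` a lift to `A` of a presentation `π : F → B`, the kernel needs, besides the `φ`-images
of the relations of `π`, one relation `φ (w z) = z` for each generator `z` of `A`. -/
theorem IsFinitelyPresentedAct.ker_isFinitelyGenerated (hB : IsFinitelyPresentedAct S B)
    (hA : (⊤ : SubMulAction S A).IsFinitelyGenerated) {g : A →[S] B}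
    (hg : Function.Surjective g) : (SMulCon.ker g).IsFinitelyGenerated := by
  obtain ⟨n, π, hπ, Y, hYfin, hYπ, hYmin⟩ := hB.exists_surjective_ker_isFinitelyGenerated
  obtain ⟨Z, hZfin, hZ⟩ := hA
  obtain ⟨φ, hφ⟩ := FreeAct.exists_comp_eq hg π
  choose w hw using fun z => hπ (g z)
  refine ⟨(fun p => (φ p.1, φ p.2)) '' Y ∪ (fun z => (φ (w z), z)) '' Z,
    (hYfin.image _).union (hZfin.image _), ?_, fun σ hσ a b (hab : g a = g b) => ?_⟩
  · rintro _ (⟨p, hp, rfl⟩ | ⟨z, -, rfl⟩)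
    · exact (hφ p.1).trans ((hYπ p hp).trans (hφ p.2).symm)
    · exact (hφ (w z)).trans (hw z)
  · let τ : SMulCon S (FreeAct S (Fin n)) :=
      { __ := σ.toSetoid.comap φ
        smul := fun s a b (h : σ.toSetoid (φ a) (φ b)) => by
          change σ.toSetoid (φ (s • a)) (φ (s • b))
          rw [map_smul, map_smul]
          exact σ.smul s h }
    have hπσ : ∀ c d, π c = π d → σ.toSetoid (φ c) (φ d) :=
      hYmin τ fun p hp => hσ _ (.inl ⟨p, hp, rfl⟩)
    have hwσ : ∀ a : A, ∃ c, π c = g a ∧ σ.toSetoid (φ c) a := by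
      intro a
      obtain ⟨z, hz, s, rfl⟩ : a ∈ {a | ∃ z ∈ Z, ∃ s : S, a = s • z} := hZ ▸ Set.mem_univ a
      refine ⟨s • w z, by rw [map_smul, map_smul, hw], ?_⟩
      rw [map_smul]
      exact σ.smul s (hσ _ (.inr ⟨z, hz, rfl⟩))
    obtain ⟨c, hc, hca⟩ := hwσ a
    obtain ⟨d, hd, hdb⟩ := hwσ b
    have hcd : σ.toSetoid (φ c) (φ d) := hπσ c d (hc.trans (hab.trans hd.symm))
    exact σ.toSetoid.trans (σ.toSetoid.symm hca) (σ.toSetoid.trans hcd hdb)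

theorem IsLeftCoherent.ker_orbitMap_isFinitelyGenerated (hS : IsLeftCoherent S) {A : Type u}
    [MulAction S A] (hA : IsFinitelyPresentedAct S A) (z : A) :
    (SMulCon.ker (orbitMap S z)).IsFinitelyGenerated := by
  let B : SubMulAction S A :=
    { carrier := MulAction.orbit S z
      smul_mem' := fun s _ => MulAction.mem_orbit_of_mem_orbit s }
  have hB : IsFinitelyPresentedAct S B := by
    refine hS A hA B ⟨{z}, Set.finite_singleton z, ?_⟩
    ext a
    simp only [Set.mem_singleton_iff, exists_eq_left, Set.mem_ofPred_eq, eq_comm (a := a)]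
    rfl
  have hS_fg : (⊤ : SubMulAction S S).IsFinitelyGenerated := by
    refine ⟨{1}, Set.finite_singleton 1, (Set.eq_univ_of_forall fun s => ?_).symm⟩
    exact ⟨1, rfl, s, (mul_one s).symm⟩
  let g : S →[S] B := orbitMap S ⟨z, MulAction.mem_orbit_self z⟩
  have hg : Function.Surjective g := fun ⟨_, s, hs⟩ => ⟨s, Subtype.ext hs⟩
  have hker : SMulCon.ker g = SMulCon.ker (orbitMap S z) := by
    rw [SMulCon.mk.injEq]
    exact Setoid.ext fun _ _ => Subtype.ext_iff
  exact hker ▸ hB.ker_isFinitelyGenerated hS_fg hg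

end Acts

/-! ### A criterion for non-coherence -/

section Criterion

variable {S : Type u} [Monoid S]

/-- The congruence on the free cyclic act that presents `⟨w | w = x w⟩`. -/
def powCon (x : S) : SMulCon S (FreeAct S (Fin 1)) where
  r a b := ∃ k l : ℕ, a.2 * x ^ k = b.2 * x ^ l
  iseqv := by
    refine ⟨fun a => ⟨0, 0, rfl⟩, fun ⟨k, l, h⟩ => ⟨l, k, h.symm⟩, ?_⟩
    rintro a b c ⟨k, l, hab⟩ ⟨k', l', hbc⟩
    refine ⟨k + k', l' + l, ?_⟩
    calc a.2 * x ^ (k + k') = b.2 * x ^ l * x ^ k' := by rw [pow_add, ← mul_assoc, hab]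
      _ = b.2 * x ^ k' * x ^ l := by rw [mul_assoc, mul_assoc, pow_mul_comm]
      _ = c.2 * x ^ (l' + l) := by rw [hbc, pow_add, mul_assoc]
  smul := by
    rintro s a b ⟨k, l, h⟩
    refine ⟨k, l, ?_⟩
    change s * a.2 * x ^ k = s * b.2 * x ^ l
    rw [mul_assoc, h, mul_assoc]

theorem powCon_isFinitelyGenerated (x : S) : (powCon x).IsFinitelyGenerated := by
  refine ⟨{(⟨0, 1⟩, ⟨0, x⟩)}, Set.finite_singleton _, ?_, fun σ hσ => ?_⟩
  · rintro _ rfl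
    exact ⟨1, 0, by simp⟩
  · have hpow : ∀ (s : S) (k : ℕ), σ.toSetoid ⟨0, s⟩ ⟨0, s * x ^ k⟩ := by
      intro s k
      induction k with
      | zero => simp
      | succ k ih =>
        have hstep : σ.toSetoid ⟨0, s * x ^ k * 1⟩ ⟨0, s * x ^ k * x⟩ :=
          σ.smul (s * x ^ k) (hσ _ rfl)
        rw [mul_one, mul_assoc, ← pow_succ] at hstep
        exact σ.toSetoid.trans ih hstep
    rintro ⟨i, a⟩ ⟨j, b⟩ ⟨k, l, h : a * x ^ k = b * x ^ l⟩
    obtain rfl := Subsingleton.elim i 0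
    obtain rfl := Subsingleton.elim j 0
    exact σ.toSetoid.trans (h ▸ hpow a k) (σ.toSetoid.symm (hpow b l))

theorem powCon_quotient_isFinitelyPresentedAct (x : S) :
    IsFinitelyPresentedAct S (powCon x).Quotient :=
  ⟨1, powCon x, powCon_isFinitelyGenerated x, MulActionHom.id S, Function.bijective_id⟩

theorem not_isLeftCoherent_of_pow (x y : S)
    (h_disjoint : ∀ (u v : S) (k l : ℕ), u * (y * x ^ k) = v * (y * x ^ l) → k = l)
    (h_strict : ∀ k, ∃ (l : ℕ) (s t : S),
      s * (y * x ^ l) = t * (y * x ^ l) ∧ s * (y * x ^ k) ≠ t * (y * x ^ k)) :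
    ¬ IsLeftCoherent S := by
  intro hS
  let z : (powCon x).Quotient := Quotient.mk (powCon x).toSetoid ⟨0, y⟩
  have h_ker : ∀ s t : S, (SMulCon.ker (orbitMap S z)).toSetoid s t ↔
      ∃ k l : ℕ, s * y * x ^ k = t * y * x ^ l := fun s t => Quotient.eq
  have h_eventually : ∀ s t : S, (SMulCon.ker (orbitMap S z)).toSetoid s t →
      ∀ᶠ n in atTop, (SMulCon.ker (orbitMap S (y * x ^ n))).toSetoid s t := by
    intro s t hst
    obtain ⟨k, l, h⟩ := (h_ker s t).1 hst
    obtain rfl := h_disjoint s t k l (by simpa only [mul_assoc] using h)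
    filter_upwards [eventually_ge_atTop k] with n hkn
    obtain ⟨d, rfl⟩ := Nat.exists_eq_add_of_le hkn
    change s * (y * x ^ (k + d)) = t * (y * x ^ (k + d))
    rw [pow_add, ← mul_assoc, ← mul_assoc, h, mul_assoc, mul_assoc]
  obtain ⟨n, hn⟩ := (eventually_forall_rel_of_isFinitelyGenerated
    (hS.ker_orbitMap_isFinitelyGenerated (powCon_quotient_isFinitelyPresentedAct x) z)
    h_eventually).exists
  obtain ⟨l, s, t, hl, hne⟩ := h_strict n
  exact hne (hn s t ((h_ker s t).2 ⟨l, l, by simpa only [mul_assoc] using hl⟩))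

end Criterion

/-! ### Opposites and examples of Ehresmann monoids -/

theorem LeftEhresmannMonoid.plus_identities (S : Type u) [LeftEhresmannMonoid S] :
    LeftEhresmannIdentities (plus : S → S) :=
  (leftEhresmann_iff_identities _).1 ⟨isLeftEhresmann, tildeR_plus⟩

namespace EhresmannMonoid

theorem star_identities (S : Type u) [EhresmannMonoid S] :
    RightEhresmannIdentities (star : S → S) :=
  (rightEhresmann_iff_identities _).1 ⟨isRightEhresmann, tildeL_star⟩

/-- The Ehresmann monoid structure given by operations that satisfy the identities. -/
abbrev ofIdentities {S : Type u} [Monoid S] (p q : S → S) (hp : LeftEhresmannIdentities p)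
    (hq : RightEhresmannIdentities q) (hr : Set.range q = Set.range p) : EhresmannMonoid S where
  plus := p
  isLeftEhresmann := ((leftEhresmann_iff_identities p).2 hp).1
  tildeR_plus := ((leftEhresmann_iff_identities p).2 hp).2
  star := q
  range_star := hr
  isRightEhresmann := ((rightEhresmann_iff_identities q).2 hq).1
  tildeL_star := ((rightEhresmann_iff_identities q).2 hq).2

/-- A monoid as an Ehresmann monoid with respect to the semilattice `{1}`. -/
abbrev trivial (S : Type u) [Monoid S] : EhresmannMonoid S :=
  .ofIdentities (fun _ => 1) (fun _ => 1)
    ⟨by simp, by simp, by simp, by simp⟩ ⟨by simp, by simp, by simp, by simp⟩ rfl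

end EhresmannMonoid

instance (S : Type u) [EhresmannMonoid S] : EhresmannMonoid Sᵐᵒᵖ :=
  have hp := LeftEhresmannMonoid.plus_identities S
  have hq := EhresmannMonoid.star_identities S
  .ofIdentities (fun a => op (EhresmannMonoid.star a.unop))
    (fun a => op (LeftEhresmannMonoid.plus a.unop))
    ⟨fun a => unop_injective (hq.self_mul_star a.unop),
      fun a b => unop_injective (hq.star_comm b.unop a.unop),
      fun a b => unop_injective (hq.star_star b.unop a.unop),
      fun a b => unop_injective (hq.star_mul b.unop a.unop)⟩
    ⟨fun a => unop_injective (hp.plus_mul_self a.unop),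
      fun a b => unop_injective (hp.plus_comm b.unop a.unop),
      fun a b => unop_injective (hp.plus_plus b.unop a.unop),
      fun a b => unop_injective (hp.plus_mul b.unop a.unop)⟩
    (by
      change Set.range (op ∘ LeftEhresmannMonoid.plus ∘ unop) =
        Set.range (op ∘ EhresmannMonoid.star ∘ unop)
      simp only [Set.range_comp, unop_surjective.range_eq, Set.image_univ,
        EhresmannMonoid.range_star])

/-- The bicyclic monoid. The pair `(a, b)` stands for the partial shift `a + n ↦ b + n` of `ℕ`, and
partial maps are composed from left to right. -/
@[ext]
structure Bicyclic where
  /-- The least element of the domain. -/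
  domMin : ℕ
  /-- The least element of the range. -/
  ranMin : ℕ

namespace Bicyclic

/-- At most one of the two truncated differences is nonzero. -/
instance : Mul Bicyclic where
  mul p q := ⟨p.domMin + (q.domMin - p.ranMin), q.ranMin + (p.ranMin - q.domMin)⟩

instance : One Bicyclic where
  one := ⟨0, 0⟩

theorem domMin_mul (p q : Bicyclic) : (p * q).domMin = p.domMin + (q.domMin - p.ranMin) := rfl

theorem ranMin_mul (p q : Bicyclic) : (p * q).ranMin = q.ranMin + (p.ranMin - q.domMin) := rfl

theorem domMin_one : (1 : Bicyclic).domMin = 0 := rfl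

theorem ranMin_one : (1 : Bicyclic).ranMin = 0 := rfl

instance : Monoid Bicyclic where
  mul_assoc p q r := by ext <;> simp only [domMin_mul, ranMin_mul] <;> omega
  one_mul p := by ext <;> simp [domMin_mul, ranMin_mul, domMin_one, ranMin_one]
  mul_one p := by ext <;> simp [domMin_mul, ranMin_mul, domMin_one, ranMin_one]

instance : EhresmannMonoid Bicyclic :=
  .ofIdentities (fun p => ⟨p.domMin, p.domMin⟩) (fun p => ⟨p.ranMin, p.ranMin⟩)
    (by constructor <;> intros <;> ext <;> simp only [domMin_mul, ranMin_mul] <;> omega)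
    (by constructor <;> intros <;> ext <;> simp only [domMin_mul, ranMin_mul] <;> omega)
    (Set.Subset.antisymm (Set.range_subset_iff.2 fun p => ⟨⟨p.ranMin, p.ranMin⟩, rfl⟩)
      (Set.range_subset_iff.2 fun p => ⟨⟨p.domMin, p.domMin⟩, rfl⟩))

theorem plus_mk (a b : ℕ) : LeftEhresmannMonoid.plus (mk a b) = mk a a := rfl

theorem mk_one_zero_pow (k : ℕ) : mk 1 0 ^ k = mk k 0 := by
  induction k with
  | zero => rfl
  | succ k ih => rw [pow_succ, ih]; rfl

end Bicyclic

/-! ### The free algebras are not coherent -/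

/-- The self-map `n ↦ n + 1`, in the monoid of self-maps of `ℕ` composed from left to right. -/
def natSucc : (Function.End ℕ)ᵐᵒᵖ := op Nat.succ

/-- The self-map `n ↦ 0`, in the monoid of self-maps of `ℕ` composed from left to right. -/
def natZero : (Function.End ℕ)ᵐᵒᵖ := op fun _ => 0

theorem unop_mul_natZero_mul_natSucc_pow (u : (Function.End ℕ)ᵐᵒᵖ) (k n : ℕ) :
    (u * (natZero * natSucc ^ k)).unop n = k := by
  induction k with
  | zero => rfl
  | succ k ih =>
    rw [pow_succ, ← mul_assoc, ← mul_assoc, mul_assoc u]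
    exact congrArg Nat.succ ih

theorem eq_of_mul_natZero_mul_natSucc_pow_eq {u v : (Function.End ℕ)ᵐᵒᵖ} {k l : ℕ}
    (h : u * (natZero * natSucc ^ k) = v * (natZero * natSucc ^ l)) : k = l := by
  rw [← unop_mul_natZero_mul_natSucc_pow u k 0, h, unop_mul_natZero_mul_natSucc_pow]

theorem LeftEhresmannMonoid.not_isLeftCoherent_of_lift {S : Type u} [LeftEhresmannMonoid S]
    (x y : S) (h_lift : ∀ (T : Type) [EhresmannMonoid T] (a b : T),
      ∃ f : S →* T, (∀ s, f (plus s) = plus (f s)) ∧ f x = a ∧ f y = b) :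
    ¬ IsLeftCoherent S := by
  refine not_isLeftCoherent_of_pow x y (fun u v k l h => ?_)
    fun k => ⟨k + 1, plus (y * x ^ (k + 1)), 1, ?_, fun h => ?_⟩
  · let _ := EhresmannMonoid.trivial (Function.End ℕ)ᵐᵒᵖ
    obtain ⟨f, -, hx, hy⟩ := h_lift (Function.End ℕ)ᵐᵒᵖ natSucc natZero
    have hf := congrArg f h
    simp only [map_mul, map_pow, hx, hy] at hf
    exact eq_of_mul_natZero_mul_natSucc_pow_eq hf
  · rw [(plus_identities S).plus_mul_self, one_mul]
  · obtain ⟨f, hplus, hx, hy⟩ := h_lift Bicyclic ⟨1, 0⟩ 1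
    have hf := congrArg (fun s => (f s).domMin) h
    simp only [map_mul, map_pow, hplus, hx, hy, one_mul, Bicyclic.mk_one_zero_pow,
      Bicyclic.plus_mk, Bicyclic.domMin_mul] at hf
    omega

theorem FLAd.exists_lift_pair {X : Type u} {x y : X} (hxy : x ≠ y) {T : Type v}
    [LeftEhresmannMonoid T] (a b : T) : ∃ f : FLAd X →* T,
      (∀ s, f (LeftEhresmannMonoid.plus s) = LeftEhresmannMonoid.plus (f s)) ∧
      f (of x) = a ∧ f (of y) = b := by
  classical
  obtain ⟨f, ⟨hplus, hf⟩, -⟩ := existsUnique_lift (Function.update (fun _ => b) x a)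
  exact ⟨f, hplus, by simp [hf], by simp [hf, hxy.symm]⟩

theorem FAd.exists_lift_pair {X : Type u} {x y : X} (hxy : x ≠ y) {T : Type v}
    [EhresmannMonoid T] (a b : T) : ∃ f : FAd X →* T,
      (∀ s, f (LeftEhresmannMonoid.plus s) = LeftEhresmannMonoid.plus (f s)) ∧
      (∀ s, f (EhresmannMonoid.star s) = EhresmannMonoid.star (f s)) ∧
      f (of x) = a ∧ f (of y) = b := by
  classical
  obtain ⟨f, ⟨hplus, hstar, hf⟩, -⟩ := existsUnique_lift (Function.update (fun _ => b) x a)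
  exact ⟨f, hplus, hstar, by simp [hf], by simp [hf, hxy.symm]⟩

theorem FAd.exists_op_lift_pair {X : Type u} {x y : X} (hxy : x ≠ y) {T : Type v}
    [EhresmannMonoid T] (a b : T) : ∃ f : (FAd X)ᵐᵒᵖ →* T,
      (∀ s, f (LeftEhresmannMonoid.plus s) = LeftEhresmannMonoid.plus (f s)) ∧
      f (op (of x)) = a ∧ f (op (of y)) = b := by
  obtain ⟨f, -, hstar, hx, hy⟩ := exists_lift_pair hxy (op a) (op b)
  exact ⟨(MulEquiv.opOp T).symm.toMonoidHom.comp (MonoidHom.op f),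
    fun s => congrArg unop (hstar s.unop), congrArg unop hx, congrArg unop hy⟩

theorem theorem5p1 (X : Type u) [Nontrivial X] :
    ¬ IsLeftCoherent (FAd X) ∧ ¬ IsRightCoherent (FAd X) ∧ ¬ IsLeftCoherent (FLAd X) := by
  obtain ⟨x, y, hxy⟩ := exists_pair_ne X
  refine ⟨LeftEhresmannMonoid.not_isLeftCoherent_of_lift (FAd.of x) (FAd.of y) ?_,
    LeftEhresmannMonoid.not_isLeftCoherent_of_lift (op (FAd.of x)) (op (FAd.of y)) ?_,
    LeftEhresmannMonoid.not_isLeftCoherent_of_lift (FLAd.of x) (FLAd.of y) ?_⟩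
  · intro T _ a b
    obtain ⟨f, hplus, -, hx, hy⟩ := FAd.exists_lift_pair hxy a b
    exact ⟨f, hplus, hx, hy⟩
  · exact fun T _ a b => FAd.exists_op_lift_pair hxy a b
  · exact fun T _ a b => FLAd.exists_lift_pair hxy a b
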